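/- Let $\mathcal I,\mathcal J$ be non-empty finite sets and $\rho:\mathcal I\times\mathcal J\to\mathbb R$ a payoff function. A forecaster and Nature play repeatedly: at each stage $m\ge 1$ they choose, independently of each other given the past, actions $i_m\in\mathcal I$ and $j_m\in\mathcal J$, whose laws are given by behavioral strategies $\sigma$ and $\tau$, i.e. maps from finite histories $(i_1,j_1,\dots,i_{m-1},j_{m-1})$ to $\Delta(\mathcal I)$ and $\Delta(\mathcal J)$ respectively; $\mathbb P_{\sigma,\tau}$ is the resulting probability on infinite histories. The average internal regret is $$\bar R_n^{ik}=\frac1n\sum_{m\le n,\ i_m=i}\big(\rho(k,j_m)-\rho(i,j_m)\big),\qquad i,k\in\mathcal I .$$ There exists a strategy $\sigma$ of the forecaster with the following properties. 1. $\sigma$ is internally consistent: for every strategy $\tau$ of Nature, $\mathbb P_{\sigma,\tau}$-almost surely, $\limsup_{n\to\infty}\bar R_n^{ik}\le 0$ for all $i,k\in\mathcal I$. 2. For every $\delta_0\in(0,1)$ there is a constant $C>0$ (depending only on the game and $\delta_0$) such that for every strategy $\tau$ of Nature, every $n\ge 1$ and every $\delta\in(0,\delta_0]$, with $\mathbb P_{\sigma,\tau}$-probability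 greater than $1-\delta$, $$\max_{i,k\in\mathcal I}\bar R_n^{ik}\le C\sqrt{\frac{\ln(1/\delta)}{n}} .$$ 3. $\sigma$ is obtained by calibrating against a Laguerre diagram that refines the best-response areas and playing the best response attached to each cell. That is, there are a finite set $\mathcal L$, sites $z(l)\in\mathbb R^{\mathcal J}$, weights $\omega(l)\in\mathbb R$, actions $i(l)\in\mathcal I$ $(l\in\mathcal L)$ and a strategy $\widehat\sigma$ of a predictor, who chooses $l_m\in\mathcal L$ at stage $m$, such that, with the Laguerre cells $P(l)=\{y\in\mathbb R^{\mathcal J}:\|y-z(l)\|^2-\omega(l)\le\|y-z(k)\|^2-\omega(k)\ \forall k\in\mathcal L\}$ and the best-response areas $B^i=\{y\in\Delta(\mathcal J): i \text{ is a best response to } y\}$: - every $B^i$ is a union of sets $P(l)\cap\Delta(\mathcal J)$, and $P(l)\cap\Delta(\mathcal J)\subset B^{i(l)}$ for every $l$; - $\widehat\sigma$ is calibrated: if $N_n(l)$ is the set of stages $m\le n$ with $l_m=l$, $\bar\jmath_n(l)\in\Delta(\mathcal J)$ is the empirical distribution of Nature's actions on $N_n(l)$, and $$c_n^{lk}=\frac{|N_n(l)|}{n}\Big(\big[\|\bar\jmath_n(l)-z(l)\|^2-\omega(l)\big]-\big[\|\bar\jmath_n(l)-z(k)\|^2-\omega(k)\big]\Big)$$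 (read as $0$ if $N_n(l)=\emptyset$), then against every strategy of Nature $\limsup_n c_n^{lk}\le0$ for all $l,k$ almost surely, and, for every $\delta_0\in(0,1)$, there is a constant $C'>0$ such that for every strategy of Nature, $n\ge1$ and $\delta\in(0,\delta_0]$, $\max_{l,k}c_n^{lk}\le C'\sqrt{\ln(1/\delta)/n}$ with probability greater than $1-\delta$; - $\sigma$ plays $i(l)$ whenever $\widehat\sigma$ selects $l$: for every strategy $\tau$ of Nature, $\mathbb P_{\sigma,\tau}$ is the law of $(i(l_m),j_m)_{m\ge1}$ when the predictor plays $\widehat\sigma$ and Nature applies $\tau$ to the history of the pairs $(i(l_m),j_m)$. -/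

import Mathlib

open MeasureTheory ProbabilityTheory Filter Topology

universe u v

noncomputable section

namespace RepeatedGame

/-! ### Strategies and the law of play -/

/-- A strategy of the forecaster: after every finite history `(i₁,j₁), …, (iₙ,jₙ)`, the law of his
next action.  `PMF I` is the set `Δ(I)` of probability distributions on `I`. -/
abbrev ForecasterStrategy (I J : Type*) := (n : ℕ) → (Fin n → I × J) → PMF I

/-- A strategy of Nature: after every finite history, the law of her next action. -/
abbrev NatureStrategy (I J : Type*) := (n : ℕ) → (Fin n → I × J) → PMF J

section Law

variable {I J : Type*} [Finite I] [Finite J]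
  [MeasurableSpace I] [MeasurableSingletonClass I]
  [MeasurableSpace J] [MeasurableSingletonClass J]

/-- Given the history, the two players draw their next actions independently. -/
def stepLaw (σ : ForecasterStrategy I J) (τ : NatureStrategy I J) (n : ℕ) (h : Fin n → I × J) :
    Measure (I × J) :=
  (σ n h).toMeasure.prod (τ n h).toMeasure

instance (σ : ForecasterStrategy I J) (τ : NatureStrategy I J) (n : ℕ) (h : Fin n → I × J) :
    IsProbabilityMeasure (stepLaw σ τ n h) := by
  unfold stepLaw; infer_instance

/-- The transition kernel from the first `n + 1` stages (numbered `0, …, n`) to the next one. -/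
def stepKernel (σ : ForecasterStrategy I J) (τ : NatureStrategy I J) (n : ℕ) :
    Kernel (Finset.Iic n → I × J) (I × J) where
  toFun h := stepLaw σ τ (n + 1)
    (fun k => h ⟨k, Finset.mem_Iic.2 (Nat.lt_succ_iff.1 k.isLt)⟩)
  measurable' := measurable_of_countable _

instance (σ : ForecasterStrategy I J) (τ : NatureStrategy I J) (n : ℕ) :
    IsMarkovKernel (stepKernel σ τ n) :=
  ⟨fun _ => inferInstanceAs (IsProbabilityMeasure (stepLaw σ τ (n + 1) _))⟩

/-- The probability `ℙ_{σ,τ}` on infinite histories generated by a pair of strategies.  In an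
infinite history `h`, the pair `h m` is the pair of actions of the `(m + 1)`-st stage. -/
def playMeasure (σ : ForecasterStrategy I J) (τ : NatureStrategy I J) : Measure (ℕ → I × J) :=
  Kernel.trajMeasure (X := fun _ => I × J) (stepLaw σ τ 0 Fin.elim0) (stepKernel σ τ)

instance (σ : ForecasterStrategy I J) (τ : NatureStrategy I J) :
    IsProbabilityMeasure (playMeasure σ τ) := by
  unfold playMeasure; infer_instance

end Law

/-! ### Internal regret -/

section Regret

variable {I J : Type*}

open Classical in
/-- The `(i,k)` coordinate of the internal regret of a stage at which `a = (iₙ, jₙ)` was played. -/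
def internalRegret (ρ : I → J → ℝ) (a : I × J) (i k : I) : ℝ :=
  if a.1 = i then ρ k a.2 - ρ i a.2 else 0

/-- The average internal regret over the first `n` stages. -/
def avgInternalRegret (ρ : I → J → ℝ) (h : ℕ → I × J) (n : ℕ) (i k : I) : ℝ :=
  (∑ m ∈ Finset.range n, internalRegret ρ (h m) i k) / n

/-- The maximum over `i, k` of the average internal regret over the first `n` stages. -/
def maxAvgInternalRegret [Fintype I] [Nonempty I] (ρ : I → J → ℝ) (h : ℕ → I × J) (n : ℕ) : ℝ :=
  Finset.univ.sup' Finset.univ_nonempty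
    (fun ik : I × I => avgInternalRegret ρ h n ik.1 ik.2)

/-- Internal consistency: against every strategy of Nature, almost surely, the upper limit of every
coordinate of the average internal regret is nonpositive (these sequences are bounded). -/
def IsInternallyConsistent [Finite I] [Finite J]
    [MeasurableSpace I] [MeasurableSingletonClass I]
    [MeasurableSpace J] [MeasurableSingletonClass J]
    (ρ : I → J → ℝ) (σ : ForecasterStrategy I J) : Prop :=
  ∀ τ : NatureStrategy I J, ∀ᵐ h ∂(playMeasure σ τ),
    ∀ i k : I, limsup (fun n => avgInternalRegret ρ h n i k) atTop ≤ 0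

end Regret

/-! ### Best responses -/

section BestResponse

variable {I J : Type*} [Fintype I] [Fintype J]

/-- The simplex `Δ(J)`, as a subset of the Euclidean space `ℝ^J`. -/
def simplex (J : Type*) [Fintype J] : Set (EuclideanSpace ℝ J) :=
  {y | (fun j => y j) ∈ stdSimplex ℝ J}

/-- The bilinear extension of the payoff to mixed actions. -/
def mixedPayoff (ρ : I → J → ℝ) (x : EuclideanSpace ℝ I) (y : EuclideanSpace ℝ J) : ℝ :=
  ∑ i, ∑ j, x i * y j * ρ i j

/-- The best response correspondence. -/
def bestResponse (ρ : I → J → ℝ) (y : EuclideanSpace ℝ J) : Set (EuclideanSpace ℝ I) :=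
  {x | x ∈ simplex I ∧ ∀ z ∈ simplex I, mixedPayoff ρ z y ≤ mixedPayoff ρ x y}

open Classical in
/-- The best response area of the pure action `i`: the mixed actions of Nature to which `i` (that
is, the Dirac mass at `i`) is a best response. -/
def bestResponseArea (ρ : I → J → ℝ) (i : I) : Set (EuclideanSpace ℝ J) :=
  {y | y ∈ simplex J ∧ EuclideanSpace.single i (1 : ℝ) ∈ bestResponse ρ y}

end BestResponse

/-! ### Laguerre diagrams and calibration -/

section Laguerre

variable {I J L : Type*} [Fintype J]

/-- The Laguerre cell of index `l`, for the sites `z` and the weights `w`. -/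
def laguerreCell (z : L → EuclideanSpace ℝ J) (w : L → ℝ) (l : L) : Set (EuclideanSpace ℝ J) :=
  {y | ∀ k, ‖y - z l‖ ^ 2 - w l ≤ ‖y - z k‖ ^ 2 - w k}

/-- The Laguerre diagram refines the decomposition of the simplex into best response areas: every
area is a union of (traces on the simplex of) cells. -/
def RefinesBestResponse [Fintype I] (ρ : I → J → ℝ) (z : L → EuclideanSpace ℝ J) (w : L → ℝ) :
    Prop :=
  ∀ i : I, ∃ S : Set L, bestResponseArea ρ i = ⋃ l ∈ S, laguerreCell z w l ∩ simplex J

open Classical in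
/-- `N_n(l)`: those among the first `n` stages at which `l` was played. -/
def stagesOf (h : ℕ → L × J) (n : ℕ) (l : L) : Finset ℕ :=
  (Finset.range n).filter (fun m => (h m).1 = l)

open Classical in
/-- The empirical distribution of Nature's actions on `N_n(l)` (irrelevant if `N_n(l)` is empty). -/
def empirical (h : ℕ → L × J) (n : ℕ) (l : L) : EuclideanSpace ℝ J :=
  ((stagesOf h n l).card : ℝ)⁻¹ •
    ∑ m ∈ stagesOf h n l, EuclideanSpace.single (h m).2 (1 : ℝ)

/-- The calibration score of the index `l` against the index `k` after `n` stages. -/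
def calibrationScore (z : L → EuclideanSpace ℝ J) (w : L → ℝ) (h : ℕ → L × J) (n : ℕ) (l k : L) :
    ℝ :=
  ((stagesOf h n l).card : ℝ) / n *
    ((‖empirical h n l - z l‖ ^ 2 - w l) - (‖empirical h n l - z k‖ ^ 2 - w k))

/-- A strategy of a predictor, who chooses at every stage an index `l` of a cell, is calibrated
with respect to the sites `z` and the weights `w`: against every strategy of Nature, almost surely,
the upper limit of every score is nonpositive and, moreover, the largest score after `n` stages is
`O(√(ln(1/δ)/n))` with probability greater than `1 - δ`. -/
def IsCalibrated [Finite L] [MeasurableSpace L] [MeasurableSingletonClass L]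
    [MeasurableSpace J] [MeasurableSingletonClass J]
    (z : L → EuclideanSpace ℝ J) (w : L → ℝ) (σ' : ForecasterStrategy L J) : Prop :=
  (∀ τ : NatureStrategy L J, ∀ᵐ h ∂(playMeasure σ' τ),
    ∀ l k : L, limsup (fun n => calibrationScore z w h n l k) atTop ≤ 0) ∧
  ∀ δ₀ : ℝ, 0 < δ₀ → δ₀ < 1 → ∃ C : ℝ, 0 < C ∧
    ∀ τ : NatureStrategy L J, ∀ n : ℕ, 1 ≤ n → ∀ δ : ℝ, 0 < δ → δ ≤ δ₀ →
      1 - δ < (playMeasure σ' τ).real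
        {h | ∀ l k : L, calibrationScore z w h n l k ≤ C * √(Real.log (1 / δ) / n)}

/-- The forecaster plays the action `a l` whenever the predictor's strategy `σ'` selects `l`.  Nature
observes (and the history of the game records) only the actions `a l`, so this says that against
every strategy `τ` of Nature the law of play under `σ` is the image, under `l ↦ a l` at every stage,
of the law of play under `σ'`. -/
def PlaysThrough [Finite I] [Finite L] [MeasurableSpace I] [MeasurableSingletonClass I]
    [MeasurableSpace L] [MeasurableSingletonClass L]
    [MeasurableSpace J] [MeasurableSingletonClass J]
    (a : L → I) (σ' : ForecasterStrategy L J) (σ : ForecasterStrategy I J) : Prop :=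
  ∀ τ : NatureStrategy I J,
    playMeasure σ τ =
      (playMeasure σ' (fun n g => τ n (fun m => (a (g m).1, (g m).2)))).map
        (fun h m => (a (h m).1, (h m).2))

end Laguerre

end RepeatedGame

end

noncomputable section

namespace RepeatedGame

open Finset

/-! ### Balanced distributions -/

/-! Calibration and internal consistency are one problem here. With site half the payoff vector of
`i` and weight its squared norm, `‖y - z i‖² - ω i` equals `‖y‖²` minus the payoff of `i` against
`y`. So the cells, indexed by `I` itself, meet the simplex in the best-response areas
(`bestResponseArea_eq`), and calibration scores are average internal regrets
(`calibrationScore_payoff`). One strategy then serves as both forecaster and predictor.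

That strategy is regret matching. Let `V` be the squared norm of the positive part of the total
regret and `D` a bound on the squared one-stage regret. Then `V` grows at each stage by at most `2 *
drift + D`, where the drift has conditional mean zero (`sum_regretMatching_mul_drift`) and square at
most `D * V`. Hoeffding's lemma turns this into a recursion for exponential moments of `V`, solved
by letting the rate decrease with the stage (`lintegral_exp_potential_le`). Markov's inequality
gives the `√(ln(1/δ)/n)` bound, and Borel–Cantelli the almost sure statement. -/

/-- Every nonnegative matrix `A` admits a probability distribution that balances, at every state,
the inflow and the outflow along the rates `A`. -/
theorem exists_pmf_balanced {I : Type*} [Fintype I] [Nonempty I] (A : I → I → ℝ)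
    (hA : ∀ i k, 0 ≤ A i k) :
    ∃ p : PMF I, ∀ k, ∑ i, (p i).toReal * A i k = (p k).toReal * ∑ i, A k i := by
  classical
  set D : I → ℝ := fun k => ∑ i, A k i with hD
  -- The rows of `Q` sum to zero, so `Q` is singular and has a left null vector, possibly of mixed
  -- signs.
  let Q : Matrix I I ℝ := fun i k => A i k - if i = k then D k else 0
  have hQ : Q.det = 0 := by
    refine Matrix.exists_mulVec_eq_zero_iff.1 ⟨fun _ => 1, ?_, ?_⟩
    · obtain ⟨i⟩ := ‹Nonempty I›
      exact fun h => one_ne_zero (congrFun h i)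
    · ext i
      simp [Matrix.mulVec, dotProduct, Q, hD]
  obtain ⟨v, hv0, hv⟩ := Matrix.exists_vecMul_eq_zero_iff.2 hQ
  have hbal : ∀ k, ∑ i, v i * A i k = v k * D k := by
    intro k
    have := congrFun hv k
    simpa [Matrix.vecMul, dotProduct, Q, mul_sub, sub_eq_zero] using this
  -- Taking absolute values keeps the balance: the triangle inequality holds at each `k`, and both
  -- sides have the same total, so it is an equality everywhere.
  have hle : ∀ k ∈ univ, |v k| * D k ≤ ∑ i, |v i| * A i k := by
    intro k _
    have hDk : 0 ≤ D k := sum_nonneg fun i _ => hA k i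
    calc |v k| * D k = |∑ i, v i * A i k| := by rw [hbal, abs_mul, abs_of_nonneg hDk]
      _ ≤ ∑ i, |v i * A i k| := abs_sum_le_sum_abs _ _
      _ = ∑ i, |v i| * A i k := by simp_rw [abs_mul, abs_of_nonneg (hA _ _)]
  have hsum : ∑ k, |v k| * D k = ∑ k, ∑ i, |v i| * A i k := by
    rw [sum_comm]
    simp_rw [hD, mul_sum]
  have heq := (sum_eq_sum_iff_of_le hle).1 hsum
  set s := ∑ i, |v i| with hs
  have hspos : 0 < s := by
    obtain ⟨i, hi⟩ := Function.ne_iff.1 hv0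
    exact sum_pos' (fun _ _ => abs_nonneg _) ⟨i, mem_univ i, abs_pos.2 hi⟩
  have hnn : ∀ i, 0 ≤ |v i| / s := fun i => div_nonneg (abs_nonneg _) hspos.le
  refine ⟨PMF.ofFintype (fun i => ENNReal.ofReal (|v i| / s)) ?_, fun k => ?_⟩
  · rw [← ENNReal.ofReal_sum_of_nonneg fun i _ => hnn i, ← sum_div, ← hs, div_self hspos.ne',
      ENNReal.ofReal_one]
  · simp only [PMF.ofFintype_apply, ENNReal.toReal_ofReal (hnn _)]
    have := heq k (mem_univ k)
    simp_rw [div_mul_eq_mul_div, ← sum_div]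
    rw [← this]

/-! ### The one-step decomposition of the law of play -/

section Law

variable {I J : Type*} [Finite I] [Finite J]
  [MeasurableSpace I] [MeasurableSingletonClass I]
  [MeasurableSpace J] [MeasurableSingletonClass J]

/-- `stepKernel` covers only stages with a nonempty past; this handles the initial one. -/
theorem map_eval_zero_playMeasure (σ : ForecasterStrategy I J) (τ : NatureStrategy I J) :
    (playMeasure σ τ).map (fun h => h 0) = stepLaw σ τ 0 Fin.elim0 := by
  have h1 : (fun h : ℕ → I × J => h 0) =
      (MeasurableEquiv.piUnique (fun _ : Finset.Iic 0 => I × J)) ∘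
        Preorder.frestrictLe (π := fun _ => I × J) 0 := by
    ext1 h; rfl
  rw [h1, ← Measure.map_map (by fun_prop) (by fun_prop), playMeasure, Kernel.trajMeasure,
    Measure.map_comp _ _ (by fun_prop), Kernel.traj_map_frestrictLe, Kernel.partialTraj_self,
    Measure.id_comp, Measure.map_map (by fun_prop) (by fun_prop)]
  exact Measure.map_id

/-- The action pair of a stage is drawn, given the past, from the step law. -/
theorem lintegral_playMeasure_step (σ : ForecasterStrategy I J) (τ : NatureStrategy I J) (n : ℕ)
    (f : (Fin n → I × J) → I × J → ENNReal) :
    ∫⁻ h, f (fun m => h m) (h n) ∂(playMeasure σ τ) =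
      ∫⁻ h, ∫⁻ a, f (fun m => h m) a ∂(stepLaw σ τ n (fun m => h m)) ∂(playMeasure σ τ) := by
  cases n with
  | zero =>
    have h0 : ∀ g : Fin 0 → I × J, g = Fin.elim0 := fun g => Subsingleton.elim _ _
    simp only [h0, lintegral_const, measure_univ, mul_one]
    rw [← map_eval_zero_playMeasure σ τ, lintegral_map .of_discrete (by fun_prop)]
  | succ n =>
    let r : (Finset.Iic n → I × J) → Fin (n + 1) → I × J :=
      fun h k => h ⟨k, Finset.mem_Iic.2 (Nat.lt_succ_iff.1 k.isLt)⟩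
    have key := Kernel.map_frestrictLe_trajMeasure_compProd_eq_map_trajMeasure
      (X := fun _ => I × J) (μ₀ := stepLaw σ τ 0 Fin.elim0) (κ := stepKernel σ τ) (a := n)
    have h1 := congrArg (fun μ => ∫⁻ x, f (r x.1) x.2 ∂μ) key
    rw [Measure.lintegral_compProd .of_discrete, lintegral_map .of_discrete (by fun_prop),
      lintegral_map .of_discrete (by fun_prop)] at h1
    exact h1.symm

/-- By independence the forecaster's action can be averaged first, for each fixed `j`; a
cancellation valid for every `j` then holds whatever Nature does. -/
theorem integral_stepLaw [Fintype I] (σ : ForecasterStrategy I J) (τ : NatureStrategy I J) (n : ℕ)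
    (g : Fin n → I × J) (f : I × J → ℝ) :
    ∫ a, f a ∂(stepLaw σ τ n g) =
      ∫ j, ∑ i, (σ n g i).toReal * f (i, j) ∂(τ n g).toMeasure := by
  unfold stepLaw
  rw [integral_prod_symm _ .of_finite]
  refine integral_congr_ae (.of_forall fun j => ?_)
  simp [PMF.integral_eq_sum]

end Law

/-! ### The regret matching strategy -/

section Potential

variable {I J : Type*}

/-- The sum of the internal regrets of the stages of a finite history. -/
def totalRegret (ρ : I → J → ℝ) {n : ℕ} (g : Fin n → I × J) (i k : I) : ℝ :=
  ∑ m, internalRegret ρ (g m) i k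

/-- The squared Euclidean distance of the total internal regret to the negative orthant. -/
def potential [Fintype I] (ρ : I → J → ℝ) {n : ℕ} (g : Fin n → I × J) : ℝ :=
  ∑ i, ∑ k, (max (totalRegret ρ g i k) 0) ^ 2

theorem avgInternalRegret_eq (ρ : I → J → ℝ) (h : ℕ → I × J) (n : ℕ) (i k : I) :
    avgInternalRegret ρ h n i k = totalRegret ρ (fun m : Fin n => h m) i k / n := by
  rw [avgInternalRegret, totalRegret, sum_range]

variable [Fintype I]

theorem potential_nonneg (ρ : I → J → ℝ) {n : ℕ} (g : Fin n → I × J) : 0 ≤ potential ρ g :=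
  sum_nonneg fun _ _ => sum_nonneg fun _ _ => sq_nonneg _

theorem totalRegret_le_sqrt_potential (ρ : I → J → ℝ) {n : ℕ} (g : Fin n → I × J) (i k : I) :
    totalRegret ρ g i k ≤ √(potential ρ g) := by
  refine (le_max_left _ 0).trans (Real.le_sqrt_of_sq_le ?_)
  refine le_trans ?_ (single_le_sum (fun i _ => sum_nonneg fun k _ => sq_nonneg _) (mem_univ i))
  exact single_le_sum (f := fun k => max (totalRegret ρ g i k) 0 ^ 2) (fun k _ => sq_nonneg _)
    (mem_univ k)

/-- The inner product of the positive part of the total regret with the regret of a stage. -/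
def drift (ρ : I → J → ℝ) {n : ℕ} (g : Fin n → I × J) (a : I × J) : ℝ :=
  ∑ i, ∑ k, max (totalRegret ρ g i k) 0 * internalRegret ρ a i k

/-- The distance from `x + y` to the negative half-line is at most its distance to `min x 0`, the
projection of `x`. -/
theorem sq_max_add_zero_le (x y : ℝ) :
    max (x + y) 0 ^ 2 ≤ max x 0 ^ 2 + 2 * (max x 0 * y) + y ^ 2 := by
  have h : max (x + y) 0 ≤ |max x 0 + y| :=
    max_le ((add_le_add_left (le_max_left x 0) y).trans (le_abs_self _)) (abs_nonneg _)
  calc max (x + y) 0 ^ 2 ≤ |max x 0 + y| ^ 2 := by gcongr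
    _ = _ := by rw [sq_abs]; ring

theorem potential_succ_le (ρ : I → J → ℝ) (h : ℕ → I × J) (n : ℕ) :
    potential ρ (fun m : Fin (n + 1) => h m) ≤
      potential ρ (fun m : Fin n => h m) + 2 * drift ρ (fun m : Fin n => h m) (h n) +
        ∑ i, ∑ k, internalRegret ρ (h n) i k ^ 2 := by
  simp only [potential, drift, mul_sum, ← sum_add_distrib]
  refine sum_le_sum fun i _ => sum_le_sum fun k _ => ?_
  have : totalRegret ρ (fun m : Fin (n + 1) => h m) i k =
      totalRegret ρ (fun m : Fin n => h m) i k + internalRegret ρ (h n) i k := by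
    simp [totalRegret, Fin.sum_univ_castSucc]
  rw [this]
  exact sq_max_add_zero_le _ _

/-- Cauchy–Schwarz. As the range of the drift is of order the square root of the potential, the
Hoeffding exponent is linear in the potential and can be absorbed into the rate. -/
theorem drift_sq_le (ρ : I → J → ℝ) {n : ℕ} (g : Fin n → I × J) (a : I × J) :
    drift ρ g a ^ 2 ≤ potential ρ g * ∑ i, ∑ k, internalRegret ρ a i k ^ 2 := by
  simp only [drift, potential, ← Fintype.sum_prod_type']
  exact sum_mul_sq_le_sq_mul_sq _ _ _

/-- A strictly positive bound on the squared norm of the one-stage internal regret. -/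
def regretBound [Fintype J] (ρ : I → J → ℝ) : ℝ :=
  1 + ∑ a : I × J, ∑ i, ∑ k, internalRegret ρ a i k ^ 2

theorem sum_sq_nonneg (ρ : I → J → ℝ) (a : I × J) :
    0 ≤ ∑ i, ∑ k, internalRegret ρ a i k ^ 2 :=
  sum_nonneg fun _ _ => sum_nonneg fun _ _ => sq_nonneg _

theorem regretBound_pos [Fintype J] (ρ : I → J → ℝ) : 0 < regretBound ρ :=
  add_pos_of_pos_of_nonneg one_pos (sum_nonneg fun a _ => sum_sq_nonneg ρ a)

theorem sum_sq_internalRegret_le [Fintype J] (ρ : I → J → ℝ) (a : I × J) :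
    ∑ i, ∑ k, internalRegret ρ a i k ^ 2 ≤ regretBound ρ := by
  have := single_le_sum (fun a _ => sum_sq_nonneg ρ a) (mem_univ a)
  unfold regretBound
  linarith

theorem avgInternalRegret_le_sqrt [Fintype J] (ρ : I → J → ℝ) (h : ℕ → I × J) {n : ℕ} (hn : 1 ≤ n) {t : ℝ}
    (ht : potential ρ (fun m : Fin n => h m) ≤ 4 * regretBound ρ * n * t) (i k : I) :
    avgInternalRegret ρ h n i k ≤ √(4 * regretBound ρ * t / n) := by
  have hn' : (0 : ℝ) < n := by exact_mod_cast hn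
  rw [avgInternalRegret_eq, div_le_iff₀ hn']
  refine (totalRegret_le_sqrt_potential ρ _ i k).trans ?_
  have : √(4 * regretBound ρ * t / n) * n = √(4 * regretBound ρ * n * t) := by
    rw [show 4 * regretBound ρ * n * t = 4 * regretBound ρ * t / n * n ^ 2 by field_simp,
      Real.sqrt_mul' _ (sq_nonneg _), Real.sqrt_sq hn'.le]
  rw [this]
  exact Real.sqrt_le_sqrt ht

/-- A real `limsup` can be compared only for sequences bounded from below in this way. -/
theorem neg_sqrt_le_avgInternalRegret [Fintype J] (ρ : I → J → ℝ) (h : ℕ → I × J) (i k : I) (n : ℕ) :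
    -√(regretBound ρ) ≤ avgInternalRegret ρ h n i k := by
  have hr : ∀ a : I × J, -√(regretBound ρ) ≤ internalRegret ρ a i k := by
    intro a
    refine (abs_le.1 (Real.abs_le_sqrt ?_)).1
    refine le_trans ?_ (sum_sq_internalRegret_le ρ a)
    refine le_trans ?_ (single_le_sum (fun i _ => sum_nonneg fun k _ => sq_nonneg _) (mem_univ i))
    exact single_le_sum (f := fun k => internalRegret ρ a i k ^ 2) (fun k _ => sq_nonneg _)
      (mem_univ k)
  rcases Nat.eq_zero_or_pos n with rfl | hn
  · simp [avgInternalRegret]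
  · have hn' : (0 : ℝ) < n := by exact_mod_cast hn
    rw [avgInternalRegret, le_div_iff₀ hn']
    have := card_nsmul_le_sum (range n) (fun m => internalRegret ρ (h m) i k) _ fun m _ => hr (h m)
    simpa [mul_comm] using this

variable [Nonempty I]

/-- The forecaster plays a distribution that balances the positive part of the total internal
regret, seen as a matrix of transition rates. -/
def regretMatching (ρ : I → J → ℝ) : ForecasterStrategy I J := fun _ g =>
  (exists_pmf_balanced (fun i k => max (totalRegret ρ g i k) 0) fun _ _ => le_max_right _ _).choose

theorem regretMatching_balanced (ρ : I → J → ℝ) {n : ℕ} (g : Fin n → I × J) (k : I) :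
    ∑ i, (regretMatching ρ n g i).toReal * max (totalRegret ρ g i k) 0 =
      (regretMatching ρ n g k).toReal * ∑ i, max (totalRegret ρ g k i) 0 :=
  (exists_pmf_balanced (fun i k => max (totalRegret ρ g i k) 0)
    fun _ _ => le_max_right _ _).choose_spec k

/-- Blackwell's condition: in the sum of `p i * A i k * (ρ k j - ρ i j)`, balance makes the inflow
at each state, which multiplies its payoff, equal to the outflow. -/
theorem sum_regretMatching_mul_drift (ρ : I → J → ℝ) {n : ℕ} (g : Fin n → I × J) (j : J) :
    ∑ i, (regretMatching ρ n g i).toReal * drift ρ g (i, j) = 0 := by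
  have h1 : ∀ i, drift ρ g (i, j) =
      ∑ k, max (totalRegret ρ g i k) 0 * (ρ k j - ρ i j) := by
    intro i
    rw [drift, sum_eq_single i]
    · simp [internalRegret]
    · intro b _ hb
      simp [internalRegret, hb.symm]
    · simp
  have h2 : ∑ i, ∑ k, (regretMatching ρ n g i).toReal * (max (totalRegret ρ g i k) 0 * ρ k j) =
      ∑ i, ∑ k, (regretMatching ρ n g i).toReal * (max (totalRegret ρ g i k) 0 * ρ i j) := by
    rw [sum_comm]
    refine sum_congr rfl fun k _ => ?_
    simp_rw [← mul_assoc, ← sum_mul]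
    rw [regretMatching_balanced, mul_sum]
  simp_rw [h1, mul_sum, mul_sub, sum_sub_distrib]
  rw [h2, sub_self]

end Potential

/-! ### Exponential moments of the potential -/

section Concentration

theorem tendsto_sqrt_log_sq_div :
    Tendsto (fun n : ℕ => √(Real.log (1 / (1 / ((n : ℝ) + 2) ^ 2)) / n)) atTop (𝓝 0) := by
  -- At `x = n + 2` the denominator `1 * x + -2` is `n`.
  have h1 : Tendsto (fun n : ℕ => 2 * (Real.log ((n : ℝ) + 2) ^ 1 / (1 * ((n : ℝ) + 2) + -2)))
      atTop (𝓝 (2 * 0)) :=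
    ((Real.tendsto_pow_log_div_mul_add_atTop 1 (-2) 1 one_ne_zero).comp
      (tendsto_atTop_add_const_right _ 2 tendsto_natCast_atTop_atTop)).const_mul 2
  have h2 := h1.sqrt
  rw [mul_zero, Real.sqrt_zero] at h2
  refine h2.congr fun n => ?_
  rw [one_div_one_div, Real.log_pow, pow_one]
  push_cast
  ring_nf

variable {I J : Type*} [Fintype I] [Fintype J]
  [MeasurableSpace I] [MeasurableSingletonClass I]
  [MeasurableSpace J] [MeasurableSingletonClass J]

theorem measurable_potential (ρ : I → J → ℝ) (n : ℕ) :
    Measurable fun h : ℕ → I × J => potential ρ (fun m : Fin n => h m) :=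
  (Measurable.of_discrete (f := fun g : Fin n → I × J => potential ρ g)).comp
    (measurable_pi_lambda _ fun _ => measurable_pi_apply _)

variable [Nonempty I]

/-- Hoeffding's lemma for a centred variable in `[-s, s]`, where `s ^ 2` is the potential times
`regretBound ρ`. -/
theorem integral_exp_drift_le (ρ : I → J → ℝ) (τ : NatureStrategy I J) {n : ℕ}
    (g : Fin n → I × J) (t : ℝ) :
    ∫ a, Real.exp (t * drift ρ g a) ∂(stepLaw (regretMatching ρ) τ n g) ≤
      Real.exp (regretBound ρ * potential ρ g * t ^ 2 / 2) := by
  set s := √(potential ρ g * regretBound ρ) with hs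
  have hmem : ∀ a, drift ρ g a ∈ Set.Icc (-s) s := fun a => by
    rw [Set.mem_Icc, ← abs_le]
    refine Real.abs_le_sqrt ((drift_sq_le ρ g a).trans ?_)
    exact mul_le_mul_of_nonneg_left (sum_sq_internalRegret_le ρ a) (potential_nonneg ρ g)
  have hmean : ∫ a, drift ρ g a ∂(stepLaw (regretMatching ρ) τ n g) = 0 := by
    rw [integral_stepLaw]
    simp [sum_regretMatching_mul_drift]
  have h := (hasSubgaussianMGF_of_mem_Icc_of_integral_eq_zero
    (μ := stepLaw (regretMatching ρ) τ n g) (X := drift ρ g)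
    (Measurable.of_discrete.aemeasurable) (.of_forall hmem) hmean).mgf_le t
  refine h.trans (le_of_eq ?_)
  have hs0 : 0 ≤ s := Real.sqrt_nonneg _
  have h2 : s ^ 2 = potential ρ g * regretBound ρ :=
    Real.sq_sqrt (mul_nonneg (potential_nonneg ρ g) (regretBound_pos ρ).le)
  congr 1
  push_cast
  rw [show s - -s = 2 * s by ring, Real.norm_of_nonneg (by positivity)]
  rw [show 2 * s / 2 = s by ring, h2]
  ring

/-- Hoeffding's bound at `2 * t` adds `2 * t ^ 2 * D * V` to the exponent, so one stage back the
rate `t` becomes `t * (1 + 2 * t * D)`. -/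
theorem lintegral_exp_potential_succ_le (ρ : I → J → ℝ) (τ : NatureStrategy I J) (n : ℕ) {t : ℝ}
    (ht : 0 ≤ t) :
    ∫⁻ h, ENNReal.ofReal (Real.exp (t * potential ρ (fun m : Fin (n + 1) => h m)))
        ∂(playMeasure (regretMatching ρ) τ) ≤
      ∫⁻ h, ENNReal.ofReal (Real.exp (t * (1 + 2 * t * regretBound ρ) *
        potential ρ (fun m : Fin n => h m) + t * regretBound ρ))
        ∂(playMeasure (regretMatching ρ) τ) := by
  set D := regretBound ρ with hD
  calc _ ≤ ∫⁻ h, ENNReal.ofReal (Real.exp (t * (potential ρ (fun m : Fin n => h m) + D)) *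
            Real.exp (2 * t * drift ρ (fun m : Fin n => h m) (h n)))
            ∂(playMeasure (regretMatching ρ) τ) := by
        refine lintegral_mono fun h => ENNReal.ofReal_le_ofReal ?_
        rw [← Real.exp_add]
        refine Real.exp_le_exp.2 ?_
        have h1 := potential_succ_le ρ h n
        have h2 := sum_sq_internalRegret_le ρ (h n)
        calc _ ≤ t * (potential ρ (fun m : Fin n => h m) +
                2 * drift ρ (fun m : Fin n => h m) (h n) + D) :=
              mul_le_mul_of_nonneg_left (by linarith) ht
          _ = _ := by ring
    _ = ∫⁻ h, ∫⁻ a, ENNReal.ofReal (Real.exp (t * (potential ρ (fun m : Fin n => h m) + D)) *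
            Real.exp (2 * t * drift ρ (fun m : Fin n => h m) a))
            ∂(stepLaw (regretMatching ρ) τ n (fun m => h m))
            ∂(playMeasure (regretMatching ρ) τ) :=
        lintegral_playMeasure_step (regretMatching ρ) τ n (fun g a =>
          ENNReal.ofReal (Real.exp (t * (potential ρ g + D)) * Real.exp (2 * t * drift ρ g a)))
    _ ≤ _ := by
        refine lintegral_mono fun h => ?_
        rw [← ofReal_integral_eq_lintegral_ofReal .of_finite
          (.of_forall fun a => by positivity), integral_const_mul]
        refine ENNReal.ofReal_le_ofReal ?_
        refine (mul_le_mul_of_nonneg_left (integral_exp_drift_le ρ τ _ _)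
          (Real.exp_pos _).le).trans (le_of_eq ?_)
        rw [← Real.exp_add, ← hD]
        congr 1
        ring

/-- The horizon `n` is fixed and `m` is the current stage. The rate falls with `m` just fast enough
to pay for its inflation at each step, and stays of order `1 / n` up to `m = n`. -/
theorem lintegral_exp_potential_le (ρ : I → J → ℝ) (τ : NatureStrategy I J) {n : ℕ} (hn : 1 ≤ n)
    (m : ℕ) :
    ∫⁻ h, ENNReal.ofReal (Real.exp ((2 * regretBound ρ * (n + m))⁻¹ *
        potential ρ (fun q : Fin m => h q))) ∂(playMeasure (regretMatching ρ) τ) ≤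
      ENNReal.ofReal (Real.exp (m * (2 * n : ℝ)⁻¹)) := by
  have hD := regretBound_pos ρ
  have hn' : (1 : ℝ) ≤ n := by exact_mod_cast hn
  induction m with
  | zero => simp [potential, totalRegret]
  | succ m ih =>
    have hk : (0 : ℝ) < n + m := by positivity
    refine (lintegral_exp_potential_succ_le ρ τ m (by positivity)).trans ?_
    -- With `k = n + m` this reduces to `k * (k + 2) ≤ (k + 1) ^ 2`.
    have hrate : (2 * regretBound ρ * (n + (m + 1 : ℕ)))⁻¹ *
        (1 + 2 * (2 * regretBound ρ * (n + (m + 1 : ℕ)))⁻¹ * regretBound ρ) ≤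
        (2 * regretBound ρ * (n + m))⁻¹ := by
      push_cast
      set k : ℝ := n + m with hkdef
      rw [← add_assoc, ← hkdef]
      have : (2 * regretBound ρ * (k + 1))⁻¹ *
          (1 + 2 * (2 * regretBound ρ * (k + 1))⁻¹ * regretBound ρ) =
          (k + 2) / (2 * regretBound ρ * (k + 1) ^ 2) := by
        field_simp
        ring
      rw [this, inv_eq_one_div, div_le_div_iff₀ (by positivity) (by positivity)]
      nlinarith
    have hconst : (2 * regretBound ρ * (n + (m + 1 : ℕ)))⁻¹ * regretBound ρ ≤ (2 * n : ℝ)⁻¹ := by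
      have : (2 * regretBound ρ * (n + (m + 1 : ℕ)))⁻¹ * regretBound ρ =
          (2 * (n + (m + 1 : ℕ)) : ℝ)⁻¹ := by
        field_simp
      rw [this]
      gcongr
      simp
      positivity
    calc _ ≤ ∫⁻ h, ENNReal.ofReal (Real.exp ((2 * n : ℝ)⁻¹)) *
              ENNReal.ofReal (Real.exp ((2 * regretBound ρ * (n + m))⁻¹ *
                potential ρ (fun q : Fin m => h q))) ∂(playMeasure (regretMatching ρ) τ) := by
          refine lintegral_mono fun h => ?_
          rw [← ENNReal.ofReal_mul (Real.exp_pos _).le, ← Real.exp_add]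
          refine ENNReal.ofReal_le_ofReal (Real.exp_le_exp.2 ?_)
          rw [add_comm]
          exact add_le_add hconst (mul_le_mul_of_nonneg_right hrate (potential_nonneg ρ _))
      _ ≤ ENNReal.ofReal (Real.exp ((2 * n : ℝ)⁻¹)) *
            ENNReal.ofReal (Real.exp (m * (2 * n : ℝ)⁻¹)) := by
          rw [lintegral_const_mul' _ _ ENNReal.ofReal_ne_top]
          gcongr
      _ = _ := by
          rw [← ENNReal.ofReal_mul (Real.exp_pos _).le, ← Real.exp_add]
          push_cast
          ring_nf

/-- Markov's inequality at `m = n`, where the rate is `1 / (4 * D * n)` and the exponential moment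
at most `exp (1 / 2)`. -/
theorem playMeasure_potential_ge_le (ρ : I → J → ℝ) (τ : NatureStrategy I J) {n : ℕ} (hn : 1 ≤ n)
    (t : ℝ) :
    (playMeasure (regretMatching ρ) τ).real
      {h | 4 * regretBound ρ * n * t ≤ potential ρ (fun m : Fin n => h m)} ≤
      Real.exp (1 / 2 - t) := by
  have hD := regretBound_pos ρ
  have hn' : (0 : ℝ) < n := by exact_mod_cast hn
  have hm := lintegral_exp_potential_le ρ τ hn n
  rw [show (n : ℝ) * (2 * n : ℝ)⁻¹ = 1 / 2 by field_simp] at hm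
  have hmarkov := mul_meas_ge_le_lintegral (μ := playMeasure (regretMatching ρ) τ)
    (f := fun h => ENNReal.ofReal (Real.exp ((2 * regretBound ρ * (n + n))⁻¹ *
        potential ρ (fun q : Fin n => h q))))
    (((measurable_potential ρ n).const_mul _).exp.ennreal_ofReal) (ENNReal.ofReal (Real.exp t))
  have hset : {h : ℕ → I × J | ENNReal.ofReal (Real.exp t) ≤
      ENNReal.ofReal (Real.exp ((2 * regretBound ρ * (n + n))⁻¹ *
        potential ρ (fun q : Fin n => h q)))} =
      {h | 4 * regretBound ρ * n * t ≤ potential ρ (fun m : Fin n => h m)} := by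
    ext h
    simp only [Set.mem_ofPred_eq]
    rw [ENNReal.ofReal_le_ofReal_iff (Real.exp_pos _).le, Real.exp_le_exp, inv_mul_eq_div,
      le_div_iff₀ (by positivity)]
    constructor <;> intro h <;> linarith
  rw [hset] at hmarkov
  have h2 := ENNReal.toReal_mono ENNReal.ofReal_ne_top (hmarkov.trans hm)
  rw [ENNReal.toReal_mul, ENNReal.toReal_ofReal (Real.exp_pos _).le,
    ENNReal.toReal_ofReal (Real.exp_pos _).le] at h2
  rw [Real.exp_sub, le_div_iff₀ (Real.exp_pos _), mul_comm]
  exact h2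

/-- With high probability, the internal regret of the regret matching strategy is of the order of
`√(ln(1/δ)/n)`. -/
theorem regretMatching_concentration (ρ : I → J → ℝ) {δ₀ : ℝ} (h0 : 0 < δ₀) (h1 : δ₀ < 1) :
    ∃ C : ℝ, 0 < C ∧ ∀ τ : NatureStrategy I J, ∀ n : ℕ, 1 ≤ n → ∀ δ : ℝ, 0 < δ → δ ≤ δ₀ →
      1 - δ < (playMeasure (regretMatching ρ) τ).real
        {h | ∀ i k, avgInternalRegret ρ h n i k ≤ C * √(Real.log (1 / δ) / n)} := by
  have hD := regretBound_pos ρ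
  have hl0 : 0 < Real.log (1 / δ₀) := Real.log_pos (by rwa [lt_div_iff₀ h0, one_mul])
  -- Chosen so that `K * log (1 / δ) ≥ log (1 / δ) + 1` for all `δ ≤ δ₀`; the extra `1` beats the `1
  -- / 2` of the tail bound and makes the inequality strict.
  set K : ℝ := 1 + (Real.log (1 / δ₀))⁻¹ with hK
  have hKpos : 0 < K := by positivity
  refine ⟨√(4 * regretBound ρ * K), by positivity, fun τ n hn δ hδ hδ0 => ?_⟩
  have hl : Real.log (1 / δ₀) ≤ Real.log (1 / δ) :=
    Real.log_le_log (by positivity) (one_div_le_one_div_of_le hδ hδ0)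
  set t := K * Real.log (1 / δ) with ht
  have htl : Real.log (1 / δ) + 1 ≤ t := by
    rw [ht, hK, add_mul, one_mul]
    gcongr
    rw [inv_mul_eq_div, le_div_iff₀ hl0, one_mul]
    exact hl
  set B := {h : ℕ → I × J | 4 * regretBound ρ * n * t ≤ potential ρ (fun m : Fin n => h m)}
  have hBm : MeasurableSet B := measurableSet_le measurable_const (measurable_potential ρ n)
  have hB : (playMeasure (regretMatching ρ) τ).real B < δ := by
    refine (playMeasure_potential_ge_le ρ τ hn t).trans_lt ?_
    calc Real.exp (1 / 2 - t) < Real.exp (-Real.log (1 / δ)) := Real.exp_lt_exp.2 (by linarith)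
      _ = δ := by rw [one_div, Real.log_inv, neg_neg, Real.exp_log hδ]
  calc 1 - δ < 1 - (playMeasure (regretMatching ρ) τ).real B := by linarith
    _ = (playMeasure (regretMatching ρ) τ).real Bᶜ := (probReal_compl_eq_one_sub hBm).symm
    _ ≤ _ := by
      refine measureReal_mono fun h hh i k => ?_
      have hlt : potential ρ (fun m : Fin n => h m) < 4 * regretBound ρ * n * t := not_le.1 hh
      refine (avgInternalRegret_le_sqrt ρ h hn hlt.le i k).trans (le_of_eq ?_)
      rw [← Real.sqrt_mul (by positivity), ht]
      ring_nf

/-- Regret matching is internally consistent. -/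
theorem regretMatching_isInternallyConsistent (ρ : I → J → ℝ) :
    IsInternallyConsistent ρ (regretMatching ρ) := by
  intro τ
  obtain ⟨C, -, hC⟩ := regretMatching_concentration (J := J) ρ (δ₀ := 1 / 2) (by norm_num)
    (by norm_num)
  -- Summable, yet with `log (1 / δ n) / n` tending to zero; the shift by `2` keeps `δ n` below `1 /
  -- 2`.
  let δ : ℕ → ℝ := fun n => 1 / ((n : ℝ) + 2) ^ 2
  let G : ℕ → Set (ℕ → I × J) := fun n =>
    {h | ∀ i k, avgInternalRegret ρ h n i k ≤ C * √(Real.log (1 / δ n) / n)}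
  have hGm : ∀ n, MeasurableSet (G n) := by
    intro n
    have : G n = (fun h : ℕ → I × J => fun m : Fin n => h m) ⁻¹'
        {g | ∀ i k, totalRegret ρ g i k / n ≤ C * √(Real.log (1 / δ n) / n)} := by
      ext h
      simp [G, avgInternalRegret_eq]
    rw [this]
    exact (measurable_pi_lambda _ fun m => measurable_pi_apply _) (Set.toFinite _).measurableSet
  have hsum : Summable δ := by
    have := (summable_nat_add_iff 2).2 (Real.summable_one_div_nat_pow.2 (one_lt_two))
    simpa [δ] using this
  have hprob : ∀ n, 1 ≤ n →
      (playMeasure (regretMatching ρ) τ) (G n)ᶜ ≤ ENNReal.ofReal (δ n) := by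
    intro n hn
    have h1 := hC τ n hn (δ n) (by positivity) (by
      refine one_div_le_one_div_of_le two_pos ?_
      have : (0 : ℝ) ≤ n := Nat.cast_nonneg n
      nlinarith)
    rw [← ofReal_measureReal, probReal_compl_eq_one_sub (hGm n)]
    exact ENNReal.ofReal_le_ofReal (by linarith)
  have hbc : ∑' n, (playMeasure (regretMatching ρ) τ) (G (n + 1))ᶜ ≠ ⊤ := by
    refine ne_top_of_le_ne_top ?_
      (ENNReal.tsum_le_tsum fun n => hprob (n + 1) (Nat.le_add_left 1 n))
    exact ((summable_nat_add_iff 1).2 hsum).tsum_ofReal_ne_top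
  filter_upwards [ae_eventually_notMem hbc] with h hh i k
  have hev : ∀ᶠ n in atTop, avgInternalRegret ρ h n i k ≤ C * √(Real.log (1 / δ n) / n) := by
    obtain ⟨N, hN⟩ := eventually_atTop.1 hh
    filter_upwards [eventually_ge_atTop (N + 1)] with n hn
    obtain ⟨q, rfl⟩ : ∃ q, n = q + 1 := ⟨n - 1, by omega⟩
    exact not_not.1 (hN q (by omega)) i k
  have hlim : Tendsto (fun n : ℕ => C * √(Real.log (1 / δ n) / n)) atTop (𝓝 0) := by
    simpa only [mul_zero] using tendsto_sqrt_log_sq_div.const_mul C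
  rw [← hlim.limsup_eq]
  exact limsup_le_limsup hev
    (isCoboundedUnder_le_of_le atTop fun n => neg_sqrt_le_avgInternalRegret ρ h i k n)
    hlim.isBoundedUnder_le

end Concentration

/-! ### The Laguerre diagram of the best response areas -/

section Diagram

variable {I J : Type*} [Fintype J]

/-- The site of an action: half of its payoff vector. -/
def payoffSite (ρ : I → J → ℝ) (i : I) : EuclideanSpace ℝ J :=
  WithLp.toLp 2 fun j => ρ i j / 2

/-- The weight of an action. -/
def payoffWeight (ρ : I → J → ℝ) (i : I) : ℝ := ‖payoffSite ρ i‖ ^ 2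

/-- The weight cancels the squared norm of the site and the half cancels the `2` of the cross term;
the remaining `‖y‖ ^ 2` is common to all cells. -/
theorem norm_sub_payoffSite_sq (ρ : I → J → ℝ) (i : I) (y : EuclideanSpace ℝ J) :
    ‖y - payoffSite ρ i‖ ^ 2 - payoffWeight ρ i = ‖y‖ ^ 2 - ∑ j, y j * ρ i j := by
  rw [norm_sub_sq_real, payoffWeight]
  have : 2 * inner ℝ y (payoffSite ρ i) = ∑ j, y j * ρ i j := by
    rw [PiLp.inner_apply, mul_sum]
    refine sum_congr rfl fun j _ => ?_
    simp [payoffSite]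
    ring
  rw [this]
  ring

theorem mem_laguerreCell_payoff_iff (ρ : I → J → ℝ) (i : I) (y : EuclideanSpace ℝ J) :
    y ∈ laguerreCell (payoffSite ρ) (payoffWeight ρ) i ↔
      ∀ k, ∑ j, y j * ρ k j ≤ ∑ j, y j * ρ i j := by
  simp only [laguerreCell, Set.mem_ofPred_eq, norm_sub_payoffSite_sq, sub_le_sub_iff_left]

theorem single_mem_simplex [Fintype I] [DecidableEq I] (i : I) :
    EuclideanSpace.single i (1 : ℝ) ∈ simplex I := by
  simpa only [simplex] using! single_mem_stdSimplex ℝ i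

theorem mixedPayoff_single [Fintype I] [DecidableEq I] (ρ : I → J → ℝ) (i : I)
    (y : EuclideanSpace ℝ J) :
    mixedPayoff ρ (EuclideanSpace.single i (1 : ℝ)) y = ∑ j, y j * ρ i j := by
  rw [mixedPayoff, sum_eq_single i]
  · simp
  · intro b _ hb
    simp [hb]
  · simp

theorem mixedPayoff_eq_sum [Fintype I] (ρ : I → J → ℝ) (x : EuclideanSpace ℝ I)
    (y : EuclideanSpace ℝ J) : mixedPayoff ρ x y = ∑ i, x i * ∑ j, y j * ρ i j := by
  simp_rw [mixedPayoff, mul_sum, mul_assoc]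

/-- The best response areas are exactly the traces on the simplex of the cells of the Laguerre
diagram of the payoff vectors. -/
theorem bestResponseArea_eq [Fintype I] (ρ : I → J → ℝ) (i : I) :
    bestResponseArea ρ i = laguerreCell (payoffSite ρ) (payoffWeight ρ) i ∩ simplex J := by
  classical
  ext y
  rw [Set.mem_inter_iff, mem_laguerreCell_payoff_iff]
  constructor
  · rintro ⟨hy, -, hbr⟩
    refine ⟨fun k => ?_, hy⟩
    have := hbr _ (single_mem_simplex k)
    simpa only [mixedPayoff_single] using this
  · rintro ⟨hbr, hy⟩
    refine ⟨hy, single_mem_simplex i, fun x hx => ?_⟩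
    -- The payoff is linear in the mixed action, so beating all pure actions suffices.
    rw [mixedPayoff_single, mixedPayoff_eq_sum]
    calc ∑ k, x k * ∑ j, y j * ρ k j ≤ ∑ k, x k * ∑ j, y j * ρ i j :=
          sum_le_sum fun k _ => mul_le_mul_of_nonneg_left (hbr k) (hx.1 k)
      _ = _ := by
          have : ∑ k, x k = 1 := hx.2
          rw [← sum_mul, this, one_mul]

/-- For this diagram, the calibration scores are the average internal regrets. -/
theorem calibrationScore_payoff (ρ : I → J → ℝ) (h : ℕ → I × J) (n : ℕ) (l k : I) :
    calibrationScore (payoffSite ρ) (payoffWeight ρ) h n l k = avgInternalRegret ρ h n l k := by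
  classical
  have hemp : ∀ i, ∑ j, empirical h n l j * ρ i j =
      ((stagesOf h n l).card : ℝ)⁻¹ * ∑ m ∈ stagesOf h n l, ρ i (h m).2 := by
    intro i
    have : ∀ j, empirical h n l j = ((stagesOf h n l).card : ℝ)⁻¹ *
        ∑ m ∈ stagesOf h n l, if j = (h m).2 then 1 else 0 := by
      intro j
      simp [empirical, Pi.single_apply]
    simp_rw [this, mul_assoc, ← mul_sum, sum_mul]
    rw [sum_comm]
    simp
  have havg : avgInternalRegret ρ h n l k =
      (∑ m ∈ stagesOf h n l, (ρ k (h m).2 - ρ l (h m).2)) / n := by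
    unfold avgInternalRegret stagesOf internalRegret
    rw [sum_filter]
  rw [calibrationScore, norm_sub_payoffSite_sq, norm_sub_payoffSite_sq, sub_sub_sub_cancel_left,
    hemp, hemp, ← mul_sub, ← sum_sub_distrib, havg]
  rcases (stagesOf h n l).eq_empty_or_nonempty with h0 | h0
  · simp [h0]
  · have : ((stagesOf h n l).card : ℝ) ≠ 0 := by exact_mod_cast h0.card_pos.ne'
    field_simp

end Diagram

end RepeatedGame

end

theorem theorem1p11 {I : Type u} {J : Type v} [Fintype I] [Nonempty I] [Fintype J] [Nonempty J]
    [MeasurableSpace I] [MeasurableSingletonClass I]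
    [MeasurableSpace J] [MeasurableSingletonClass J] (ρ : I → J → ℝ) :
    ∃ σ : RepeatedGame.ForecasterStrategy I J,
      RepeatedGame.IsInternallyConsistent ρ σ ∧
      (∀ δ₀ : ℝ, 0 < δ₀ → δ₀ < 1 → ∃ C : ℝ, 0 < C ∧
        ∀ τ : RepeatedGame.NatureStrategy I J, ∀ n : ℕ, 1 ≤ n → ∀ δ : ℝ, 0 < δ → δ ≤ δ₀ →
          1 - δ < (RepeatedGame.playMeasure σ τ).real
            {h | RepeatedGame.maxAvgInternalRegret ρ h n ≤ C * √(Real.log (1 / δ) / n)}) ∧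
      ∃ (L : Type u) (_ : Fintype L) (_ : MeasurableSpace L) (_ : MeasurableSingletonClass L)
        (z : L → EuclideanSpace ℝ J) (w : L → ℝ) (a : L → I)
        (σ' : RepeatedGame.ForecasterStrategy L J),
        RepeatedGame.RefinesBestResponse ρ z w ∧
        (∀ l, RepeatedGame.laguerreCell z w l ∩ RepeatedGame.simplex J ⊆
          RepeatedGame.bestResponseArea ρ (a l)) ∧
        RepeatedGame.IsCalibrated z w σ' ∧
        RepeatedGame.PlaysThrough a σ' σ := by
  -- Cells are indexed by actions and `a = id`, so predictor and forecaster coincide and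
  -- `PlaysThrough` is the image under the identity.
  refine ⟨RepeatedGame.regretMatching ρ, RepeatedGame.regretMatching_isInternallyConsistent ρ,
    fun δ₀ h0 h1 => ?_, I, inferInstance, inferInstance, inferInstance,
    RepeatedGame.payoffSite ρ, RepeatedGame.payoffWeight ρ, id, RepeatedGame.regretMatching ρ,
    fun i => ⟨{i}, ?_⟩, fun l => (RepeatedGame.bestResponseArea_eq ρ l).ge, ⟨?_, ?_⟩, fun τ => ?_⟩
  · obtain ⟨C, hC, h⟩ := RepeatedGame.regretMatching_concentration (J := J) ρ h0 h1
    refine ⟨C, hC, fun τ n hn δ hδ hδ0 => ?_⟩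
    simpa [RepeatedGame.maxAvgInternalRegret] using h τ n hn δ hδ hδ0
  · rw [Set.biUnion_singleton, RepeatedGame.bestResponseArea_eq]
  · simp only [RepeatedGame.calibrationScore_payoff]
    exact RepeatedGame.regretMatching_isInternallyConsistent ρ
  · intro δ₀ h0 h1
    simp only [RepeatedGame.calibrationScore_payoff]
    exact RepeatedGame.regretMatching_concentration ρ h0 h1
  · exact Measure.map_id.symm
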